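/- Let $\mathcal T=[0,t_U]$ with $t_U>0$, let $m\ge 2$ and $n\ge 1$ be integers, $\sigma_U,\sigma_A>0$ and $\sigma_\mu,\sigma_\alpha\in\mathbb R$. On a probability space let $\boldsymbol\mu=(\mu_0,\dots,\mu_{m-1})\sim N_m(0,\sigma_\mu^2 I)$ and $\boldsymbol\alpha=(\alpha_0,\dots,\alpha_{n-1})\sim N_n(0,\sigma_\alpha^2 I)$ be random vectors and let $\dot W_U,\dot W_A$ be Gaussian white noises on $\mathcal T$, that is, Gaussian families $f\mapsto \int_{\mathcal T} f(u)\dot W(u)\,du$, $f\in L^2(\mathcal T)$, with mean zero and $\mathrm{Cov}\left(\int f\dot W,\int g\dot W\right)=\int_{\mathcal T} f(u)g(u)\,du$; suppose that $\boldsymbol\mu,\boldsymbol\alpha,\dot W_U,\dot W_A$ are mutually independent. Let $U$ be a nested Gaussian process, i.e. $U$ and $A$ are processes on $\mathcal T$ satisfying $$D^mU(t)=A(t)+\sigma_U\dot W_U(t),\quad D^iU(0)=\mu_i\ (0\le i\le m-1),\qquad D^nA(t)=\sigma_A\dot W_A(t),\quad D^iA(0)=\alpha_i\ (0\le i\le n-1).$$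 Here the equations mean that almost surely $U$ has $C^{m-1}$ paths and $A$ has $C^{n-1}$ paths on $\mathcal T$ with the stated initial values, and that for every $t\in\mathcal T$, almost surely, $D^{m-1}U(t)=\mu_{m-1}+\int_0^tA(s)\,ds+\sigma_U\int_0^t\dot W_U(s)\,ds$ and $D^{n-1}A(t)=\alpha_{n-1}+\sigma_A\int_0^t\dot W_A(s)\,ds$. Then there are mutually independent Gaussian processes $\tilde U_0,\tilde U_1,\tilde A_0,\tilde A_1$ on $\mathcal T$, defined on the same probability space and with mean function zero, such that $U(t)=\tilde U_0(t)+\tilde U_1(t)+\tilde A_0(t)+\tilde A_1(t)$ for all $t\in\mathcal T$, and whose covariance functions are, for $s,t\in\mathcal T$, $$\mathcal K_{\tilde U_0}(s,t)=\sigma_\mu^2\sum_{i=0}^{m-1}\phi_i(s)\phi_i(t),\qquad \mathcal K_{\tilde U_1}(s,t)=\sigma_U^2\int_{\mathcal T}G_m(s,u)G_m(t,u)\,du,$$ $$\mathcal K_{\tilde A_0}(s,t)=\sigma_\alpha^2\sum_{i=0}^{n-1}\phi_{m+i}(s)\phi_{m+i}(t),\qquad \mathcal K_{\tilde A_1}(s,t)=\sigma_A^2\int_{\mathcal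 T}G_{m+n}(s,u)G_{m+n}(t,u)\,du,$$ where $\phi_i(t)=t^i/i!$ and $G_k(s,u)=(s-u)_+^{k-1}/(k-1)!$. -/

import Mathlib

open MeasureTheory ProbabilityTheory Set

/-- The polynomial `φ_i(t) = t ^ i / i!`. -/
noncomputable def phi (i : ℕ) (t : ℝ) : ℝ := t ^ i / (i.factorial : ℝ)

/-- The kernel `G_k(s, u) = (s - u)_+ ^ (k - 1) / (k - 1)!`, used for `k ≥ 2`. -/
noncomputable def greenG (k : ℕ) (s u : ℝ) : ℝ :=
  (max (s - u) 0) ^ (k - 1) / ((k - 1).factorial : ℝ)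

/-- The Hilbert space `L²([0, T])` of square integrable functions on the time interval. -/
abbrev TimeL2 (T : ℝ) : Type := Lp ℝ 2 (volume.restrict (Icc (0 : ℝ) T))

/-- The indicator function of `[0, t]`, as an element of `L²([0, T])`. -/
noncomputable def stepL2 (T t : ℝ) : TimeL2 T :=
  indicatorConstLp 2 (measurableSet_Icc (a := (0 : ℝ)) (b := t)) (measure_ne_top _ _) (1 : ℝ)

/-- Gaussian white noise on `[0, T]`, as a generalized process: `W f` stands for
`∫ f(u) Ẇ(u) du`, `f ∈ L²([0, T])`. It is a Gaussian process with mean zero, and the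
covariance `E[Ẇ(u) Ẇ(v)] = δ(u - v)` reads `Cov(W f, W g) = ∫ f(u) g(u) du`. -/
structure IsWhiteNoise {Ω : Type*} [MeasurableSpace Ω] (P : Measure Ω) (T : ℝ)
    (W : TimeL2 T → Ω → ℝ) : Prop where
  gaussian : IsGaussianProcess W P
  mean_zero : ∀ f : TimeL2 T, ∫ ω, W f ω ∂P = 0
  covariance : ∀ f g : TimeL2 T,
    cov[W f, W g; P] = ∫ u in Icc (0 : ℝ) T, f u * g u

/-- `X` solves `D^k X(t) = B(t) + σ Ẇ(t)` on `[0, T]`, with initial values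
`D^i X(0) = x₀ i` for `i < k` (`k ≥ 1`). Almost every path of `X` is `k - 1` times continuously
differentiable with the given initial values, and the equation is read in its integrated form
`D^(k-1) X(t) = x₀ (k-1) + ∫₀ᵗ B(s) ds + σ ∫₀ᵗ Ẇ(s) ds`, almost surely for each `t`. -/
structure SolvesSDE {Ω : Type*} [MeasurableSpace Ω] (P : Measure Ω) (T : ℝ) (k : ℕ)
    (σ : ℝ) (X B : ℝ → Ω → ℝ) (x₀ : Ω → EuclideanSpace ℝ (Fin k))
    (W : TimeL2 T → Ω → ℝ) : Prop where
  smooth : ∀ᵐ ω ∂P, ContDiffOn ℝ ((k - 1 : ℕ) : WithTop ℕ∞) (fun t => X t ω) (Icc 0 T)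
  initial : ∀ᵐ ω ∂P, ∀ i : Fin k,
    iteratedDerivWithin (i : ℕ) (fun t => X t ω) (Icc 0 T) 0 = x₀ ω i
  equation : ∀ t ∈ Icc (0 : ℝ) T, ∀ᵐ ω ∂P,
    iteratedDerivWithin (k - 1) (fun t => X t ω) (Icc 0 T) t
      = iteratedDerivWithin (k - 1) (fun t => X t ω) (Icc 0 T) 0
        + (∫ s in (0 : ℝ)..t, B s ω) + σ * W (stepL2 T t) ω

/-- `U` is a nested Gaussian process on `[0, T]` of orders `m, n`, with local instantaneous mean
function `A`, random initial values `μ`, `α` and driving white noises `WU`, `WA`. -/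
structure IsNestedGP {Ω : Type*} [MeasurableSpace Ω] (P : Measure Ω) (T : ℝ) (m n : ℕ)
    (σμ σα σU σA : ℝ) (U A : ℝ → Ω → ℝ)
    (μ : Ω → EuclideanSpace ℝ (Fin m)) (α : Ω → EuclideanSpace ℝ (Fin n))
    (WU WA : TimeL2 T → Ω → ℝ) : Prop where
  noise_U : IsWhiteNoise P T WU
  noise_A : IsWhiteNoise P T WA
  law_μ : HasLaw μ (multivariateGaussian 0 (σμ ^ 2 • (1 : Matrix (Fin m) (Fin m) ℝ))) P
  law_α : HasLaw α (multivariateGaussian 0 (σα ^ 2 • (1 : Matrix (Fin n) (Fin n) ℝ))) P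
  /-- mutual independence of `μ`, `α`, `WU`, `WA` (of the σ-algebras they generate) -/
  indep : iIndep ![MeasurableSpace.comap μ inferInstance,
    MeasurableSpace.comap α inferInstance,
    MeasurableSpace.comap (fun ω f => WU f ω) MeasurableSpace.pi,
    MeasurableSpace.comap (fun ω f => WA f ω) MeasurableSpace.pi] P
  sde_U : SolvesSDE P T m σU U A μ WU
  sde_A : SolvesSDE P T n σA A (fun _ _ => 0) α WA

/-- `X` is a zero-mean Gaussian process on `[0, T]` with covariance function `K`. -/
structure IsZeroMeanGP {Ω : Type*} [MeasurableSpace Ω] (P : Measure Ω) (T : ℝ)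
    (X : Icc (0 : ℝ) T → Ω → ℝ) (K : ℝ → ℝ → ℝ) : Prop where
  gaussian : IsGaussianProcess X P
  mean_zero : ∀ t, ∫ ω, X t ω ∂P = 0
  covariance : ∀ s t, cov[X s, X t; P] = K s t

/-! White noise commutes with time integration, and everything else is Taylor's formula. Suppose a
process with continuous paths equals, almost surely at each time, a random polynomial plus `σ * W
(truncPowL2 T k t)`. Pathwise, the Riemann sums of the noise part converge to its integral. By
almost sure linearity they are also `W` of Riemann sums of kernels, which converge in L² to
`truncPowL2 T (k + 1) t`. As `W` is an isometry into L²(P), both limits are limits in probability of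
one sequence, so they agree almost surely (`IsWhiteNoise.integral_eq`). No stochastic Fubini theorem
is needed.

Iterating from the top derivative gives A as a Taylor polynomial plus a noise integral. For U,
iterated primitives of A are first subtracted (`SolvesSDE.eq_taylor`). Integrating A m times raises
each `phi i` to `phi (m + i)` and the kernel order by m.

The resulting four terms depend on μ, WU, α, WA separately, hence are independent, and their
covariances follow from those of the sources. -/

open Filter Topology

/-! ### Riemann sums -/

/-- The left Riemann sum of `f` on `[0, t]` with `N` intervals of equal length. -/
noncomputable def riemannSum {E : Type*} [AddCommGroup E] [Module ℝ E] (f : ℝ → E) (t : ℝ)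
    (N : ℕ) : E :=
  ∑ j ∈ Finset.range N, (t / N) • f (t / N * j)

lemma mul_div_mem_Icc {t : ℝ} (ht : 0 ≤ t) {N j : ℕ} (hj : j ≤ N) :
    t / N * j ∈ Icc (0 : ℝ) t := by
  have hN : (0 : ℝ) ≤ N := N.cast_nonneg
  refine ⟨by positivity, ?_⟩
  rcases hN.eq_or_lt with h | h
  · rw [← h]; simpa using ht
  · rw [div_mul_eq_mul_div, div_le_iff₀ h]
    exact mul_le_mul_of_nonneg_left (by exact_mod_cast hj) ht

lemma tendsto_riemannSum {f : ℝ → ℝ} {t : ℝ} (ht : 0 ≤ t) (hf : ContinuousOn f (Icc 0 t)) :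
    Tendsto (riemannSum f t) atTop (𝓝 (∫ s in (0 : ℝ)..t, f s)) := by
  rw [Metric.tendsto_atTop]
  intro ε hε
  have huc := isCompact_Icc.uniformContinuousOn_of_continuous hf
  -- The denominator `t + 1` also allows t = 0 and makes the total error `ε * t / (t + 1)` strictly
  -- less than ε.
  obtain ⟨δ, hδ, H⟩ := Metric.uniformContinuousOn_iff.1 huc (ε / (t + 1)) (by positivity)
  obtain ⟨N₀, hN₀⟩ := exists_nat_gt (t / δ)
  refine ⟨N₀ + 1, fun N hN => ?_⟩
  have hNpos : (0 : ℝ) < N := by exact_mod_cast (by omega : 0 < N)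
  have hstep : t / N < δ := by
    rw [div_lt_iff₀ hNpos, mul_comm, ← div_lt_iff₀ hδ]
    exact hN₀.trans (by exact_mod_cast (by omega : N₀ < N))
  have hstep0 : 0 ≤ t / N := by positivity
  have hmem : ∀ j ≤ N, t / N * j ∈ Icc (0 : ℝ) t := fun j hj => mul_div_mem_Icc ht hj
  have hmono : ∀ j : ℕ, t / N * j ≤ t / N * (j + 1 : ℕ) := fun j =>
    mul_le_mul_of_nonneg_left (by push_cast; linarith) hstep0
  have hint : ∀ j < N, IntervalIntegrable f volume (t / N * j) (t / N * (j + 1 : ℕ)) := by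
    intro j hj
    apply ContinuousOn.intervalIntegrable
    rw [uIcc_of_le (hmono j)]
    exact hf.mono (Icc_subset_Icc (hmem j hj.le).1 (hmem (j + 1) hj).2)
  have hsum := intervalIntegral.sum_integral_adjacent_intervals
    (a := fun j : ℕ => t / N * j) hint
  have htN : t / N * N = t := by field_simp
  simp only [Nat.cast_zero, mul_zero, htN] at hsum
  rw [← hsum, riemannSum, dist_eq_norm, ← Finset.sum_sub_distrib]
  have hterm : ∀ j ∈ Finset.range N, ‖(t / N) • f (t / N * j)
      - ∫ s in (t / N * j)..(t / N * (j + 1 : ℕ)), f s‖ ≤ ε / (t + 1) * (t / N) := by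
    intro j hj
    rw [Finset.mem_range] at hj
    have hlen : t / N * (j + 1 : ℕ) - t / N * j = t / N := by push_cast; ring
    have h1 : (t / N) • f (t / N * j)
        = ∫ _s in (t / N * j)..(t / N * (j + 1 : ℕ)), f (t / N * j) := by
      rw [intervalIntegral.integral_const, hlen]
    rw [h1, ← intervalIntegral.integral_sub intervalIntegrable_const (hint j hj)]
    refine (intervalIntegral.norm_integral_le_of_norm_le_const (C := ε / (t + 1)) ?_).trans ?_
    · intro x hx
      rw [uIoc_of_le (hmono j)] at hx
      rw [← dist_eq_norm]
      refine (H _ (hmem j hj.le) x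
        ⟨(hmem j hj.le).1.trans hx.1.le, hx.2.trans (hmem (j + 1) hj).2⟩ ?_).le
      rw [dist_comm, Real.dist_eq, abs_of_nonneg (by linarith [hx.1])]
      linarith [hx.2]
    · rw [hlen, abs_of_nonneg hstep0]
  refine (norm_sum_le_of_le _ hterm).trans_lt ?_
  rw [Finset.sum_const, Finset.card_range, nsmul_eq_mul]
  calc (N : ℝ) * (ε / (t + 1) * (t / N)) = ε * (t / (t + 1)) := by field_simp
    _ < ε * 1 := by
        refine mul_lt_mul_of_pos_left ?_ hε
        rw [div_lt_one (by linarith)]; linarith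
    _ = ε := mul_one ε

/-! ### Green kernels as elements of `L²` -/

/-- The kernel `(t - u)_+ ^ k / k!`, which for `k = 0` is the indicator function of `u ≤ t`. -/
noncomputable def truncPow (k : ℕ) (t u : ℝ) : ℝ :=
  if u ≤ t then (t - u) ^ k / (k.factorial : ℝ) else 0

/-- This fails for k = 0: since 0 ^ 0 = 1, `greenG 1` is constantly 1, while `truncPow 0` is an
indicator. The final covariances only need k ≥ 1, thanks to m ≥ 2. -/
lemma truncPow_eq_greenG {k : ℕ} (hk : 1 ≤ k) (t u : ℝ) :
    truncPow k t u = greenG (k + 1) t u := by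
  unfold truncPow greenG
  split_ifs with h
  · rw [max_eq_left (by linarith), Nat.add_sub_cancel]
  · rw [max_eq_right (by linarith), Nat.add_sub_cancel, zero_pow (by omega), zero_div]

lemma truncPow_nonneg (k : ℕ) (t u : ℝ) : 0 ≤ truncPow k t u := by
  unfold truncPow
  split_ifs with h
  · have : 0 ≤ t - u := by linarith
    positivity
  · exact le_rfl

lemma truncPow_le (k : ℕ) {t u : ℝ} (hu : 0 ≤ u) :
    truncPow k t u ≤ |t| ^ k / (k.factorial : ℝ) := by
  unfold truncPow
  split_ifs with h
  · have h1 : 0 ≤ t - u := by linarith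
    have h2 : t - u ≤ |t| := by linarith [le_abs_self t]
    gcongr
  · positivity

@[fun_prop]
lemma measurable_truncPow (k : ℕ) (t : ℝ) : Measurable (truncPow k t) := by
  unfold truncPow
  exact Measurable.ite measurableSet_Iic (by fun_prop) measurable_const

lemma truncPow_zero_left (k : ℕ) {u : ℝ} (hu : 0 ≤ u) : truncPow (k + 1) 0 u = 0 := by
  unfold truncPow
  split_ifs with h
  · have : u = 0 := le_antisymm h hu
    simp [this]
  · rfl

lemma mul_pow_le_pow_sub_pow {x y : ℝ} (hx : 0 ≤ x) (hxy : x ≤ y) (k : ℕ) :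
    (k + 1) * (y - x) * x ^ k ≤ y ^ (k + 1) - x ^ (k + 1) := by
  induction k with
  | zero => simp
  | succ k ih =>
    have h := mul_le_mul_of_nonneg_left ih (hx.trans hxy)
    -- This is exactly what is lost on replacing the factor y by x in the induction hypothesis
    -- multiplied by y.
    have h2 : 0 ≤ (k + 1) * (y - x) ^ 2 * x ^ k := by positivity
    push_cast
    calc _ ≤ _ := ?_
      _ ≤ y * (y ^ (k + 1) - x ^ (k + 1)) + (y - x) * x ^ (k + 1) := add_le_add_left h _
      _ = _ := by ring
    refine sub_nonneg.1 (h2.trans_eq ?_)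
    ring

lemma pow_sub_pow_le_mul_pow {x y : ℝ} (hx : 0 ≤ x) (hxy : x ≤ y) (k : ℕ) :
    y ^ (k + 1) - x ^ (k + 1) ≤ (k + 1) * (y - x) * y ^ k := by
  induction k with
  | zero => simp
  | succ k ih =>
    have h := mul_le_mul_of_nonneg_left ih (hx.trans hxy)
    have h2 : (y - x) * x ^ (k + 1) ≤ (y - x) * y ^ (k + 1) := by
      have : 0 ≤ y - x := by linarith
      gcongr
    push_cast
    calc _ = y * (y ^ (k + 1) - x ^ (k + 1)) + (y - x) * x ^ (k + 1) := by ring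
      _ ≤ _ := add_le_add h h2
      _ = _ := by ring

/-- In t, `truncPow (k + 1)` is a primitive of the nondecreasing `truncPow k`, so its increment lies
between step length times left value and step length times right value (`truncPow_sub_le`). -/
lemma mul_truncPow_le (k : ℕ) {a b : ℝ} (hab : a ≤ b) (u : ℝ) :
    (b - a) * truncPow k a u ≤ truncPow (k + 1) b u - truncPow (k + 1) a u := by
  by_cases ha : u ≤ a
  · have h := mul_pow_le_pow_sub_pow (x := a - u) (y := b - u) (by linarith) (by linarith) k
    simp only [truncPow, ha, ha.trans hab, if_true, Nat.factorial_succ, Nat.cast_mul]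
    rw [← sub_div, le_div_iff₀ (by positivity)]
    refine le_trans (le_of_eq ?_) h
    field_simp
    push_cast; ring
  · have h1 := truncPow_nonneg (k + 1) b u
    simpa [truncPow, ha] using h1

lemma truncPow_sub_le (k : ℕ) {a b : ℝ} (hab : a ≤ b) (u : ℝ) :
    truncPow (k + 1) b u - truncPow (k + 1) a u ≤ (b - a) * truncPow k b u := by
  by_cases ha : u ≤ a
  · have h := pow_sub_pow_le_mul_pow (x := a - u) (y := b - u) (by linarith) (by linarith) k
    simp only [truncPow, ha, ha.trans hab, if_true, Nat.factorial_succ, Nat.cast_mul]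
    rw [← sub_div, div_le_iff₀ (by positivity)]
    refine h.trans (le_of_eq ?_)
    field_simp
    push_cast; ring
  -- When a < u ≤ b only the upper end contributes; one factor `b - u` is bounded by `b - a`, and
  -- the extra factorial factor only helps.
  · by_cases hb : u ≤ b
    · simp only [truncPow, ha, hb, if_true, if_false, sub_zero, Nat.factorial_succ, Nat.cast_mul]
      have h0 : 0 ≤ b - u := by linarith
      have h1 : b - u ≤ b - a := by linarith
      rw [pow_succ', mul_div_assoc]
      gcongr
      have : (1 : ℝ) ≤ (k + 1 : ℕ) := by push_cast; linarith [(k.cast_nonneg : (0 : ℝ) ≤ k)]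
      exact le_mul_of_one_le_left (by positivity) this
    · simp [truncPow, ha, hb]

/-- The gaps between left and right values telescope, giving an error bound uniform in u.
Monotonicity replaces continuity, so the indicator case k = 0 is covered. -/
lemma abs_truncPow_sub_riemannSum_le (k N : ℕ) (hN : 0 < N) {t u : ℝ} (ht : 0 ≤ t)
    (hu : 0 ≤ u) :
    |truncPow (k + 1) t u - riemannSum (fun s => truncPow k s u) t N|
      ≤ t / N * (|t| ^ k / (k.factorial : ℝ)) := by
  have hN' : (0 : ℝ) < N := by exact_mod_cast hN
  have hstep0 : 0 ≤ t / N := by positivity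
  have hmono : ∀ j : ℕ, t / N * j ≤ t / N * (j + 1 : ℕ) := fun j =>
    mul_le_mul_of_nonneg_left (by push_cast; linarith) hstep0
  have hlen : ∀ j : ℕ, t / N * (j + 1 : ℕ) - t / N * j = t / N := fun j => by push_cast; ring
  have htN : t / N * N = t := by field_simp
  have h1 := Finset.sum_range_sub (fun j : ℕ => truncPow (k + 1) (t / N * j) u) N
  have h2 := Finset.sum_range_sub (fun j : ℕ => truncPow k (t / N * j) u) N
  simp only [htN, Nat.cast_zero, mul_zero, truncPow_zero_left k hu, sub_zero] at h1 h2
  rw [← h1, riemannSum, ← Finset.sum_sub_distrib, abs_of_nonneg]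
  · calc _ ≤ ∑ j ∈ Finset.range N, t / N *
          (truncPow k (t / N * (j + 1 : ℕ)) u - truncPow k (t / N * j) u) := by
          refine Finset.sum_le_sum fun j _ => ?_
          have := truncPow_sub_le k (hmono j) u
          rw [hlen] at this
          rw [smul_eq_mul]
          linarith
      _ = t / N * (truncPow k t u - truncPow k 0 u) := by rw [← Finset.mul_sum, h2]
      _ ≤ _ := by
          gcongr
          linarith [truncPow_nonneg k 0 u, truncPow_le k (t := t) hu]
  · refine Finset.sum_nonneg fun j _ => ?_
    have := mul_truncPow_le k (hmono j) u
    rw [hlen] at this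
    rw [smul_eq_mul]
    linarith

lemma memLp_truncPow (T : ℝ) (k : ℕ) (t : ℝ) :
    MemLp (truncPow k t) 2 (volume.restrict (Icc (0 : ℝ) T)) := by
  refine MemLp.of_bound (measurable_truncPow k t).aestronglyMeasurable
    (|t| ^ k / (k.factorial : ℝ)) ?_
  filter_upwards [ae_restrict_mem measurableSet_Icc] with u hu
  rw [Real.norm_of_nonneg (truncPow_nonneg k t u)]
  exact truncPow_le k hu.1

/-- The kernel `truncPow k t` as an element of `L²([0, T])`. -/
noncomputable def truncPowL2 (T : ℝ) (k : ℕ) (t : ℝ) : TimeL2 T :=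
  (memLp_truncPow T k t).toLp (truncPow k t)

lemma coeFn_truncPowL2 (T : ℝ) (k : ℕ) (t : ℝ) :
    truncPowL2 T k t =ᵐ[volume.restrict (Icc (0 : ℝ) T)] truncPow k t :=
  (memLp_truncPow T k t).coeFn_toLp

lemma stepL2_eq_truncPowL2 (T t : ℝ) : stepL2 T t = truncPowL2 T 0 t := by
  apply Lp.ext
  refine indicatorConstLp_coeFn.trans (EventuallyEq.trans ?_ (coeFn_truncPowL2 T 0 t).symm)
  filter_upwards [ae_restrict_mem measurableSet_Icc] with u hu
  simp [truncPow, indicator_apply, hu.1]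

lemma coeFn_riemannSum_truncPowL2 (T : ℝ) (k : ℕ) (t : ℝ) (N : ℕ) :
    (riemannSum (truncPowL2 T k) t N : TimeL2 T) =ᵐ[volume.restrict (Icc (0 : ℝ) T)]
      fun u => riemannSum (fun s => truncPow k s u) t N := by
  have h : ∀ j : ℕ, ((t / N) • truncPowL2 T k (t / N * j) : TimeL2 T)
      =ᵐ[volume.restrict (Icc (0 : ℝ) T)] fun u => (t / N) • truncPow k (t / N * j) u := by
    intro j
    filter_upwards [Lp.coeFn_smul (t / N) (truncPowL2 T k (t / N * j)),
      coeFn_truncPowL2 T k (t / N * j)] with u h1 h2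
    rw [h1, Pi.smul_apply, h2]
  unfold riemannSum
  generalize Finset.range N = s
  induction s using Finset.induction_on with
  | empty =>
    simp only [Finset.sum_empty]
    exact Lp.coeFn_zero _ _ _
  | insert j s hj ih =>
    simp only [Finset.sum_insert hj]
    filter_upwards [ih, h j, Lp.coeFn_add ((t / N) • truncPowL2 T k (t / N * j))
      (∑ j ∈ s, (t / N) • truncPowL2 T k (t / N * j))] with u h1 h2 h3
    rw [h3, Pi.add_apply, h1, h2]

lemma tendsto_riemannSum_truncPowL2 (T : ℝ) (k : ℕ) {t : ℝ} (ht : 0 ≤ t) :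
    Tendsto (riemannSum (truncPowL2 T k) t) atTop (𝓝 (truncPowL2 T (k + 1) t)) := by
  rw [tendsto_iff_norm_sub_tendsto_zero]
  set μ : Measure ℝ := volume.restrict (Icc (0 : ℝ) T)
  -- The factor comparing the L² norm with a uniform bound on a finite measure space.
  set K : ℝ := (measureUnivNNReal μ : ℝ) ^ ((2 : ENNReal).toReal⁻¹)
  have hb : ∀ᶠ N : ℕ in atTop, ‖riemannSum (truncPowL2 T k) t N - truncPowL2 T (k + 1) t‖
      ≤ K * (t / N * (|t| ^ k / (k.factorial : ℝ))) := by
    filter_upwards [eventually_gt_atTop 0] with N hN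
    refine Lp.norm_le_of_ae_bound (by positivity) ?_
    filter_upwards [coeFn_riemannSum_truncPowL2 T k t N, coeFn_truncPowL2 T (k + 1) t,
      Lp.coeFn_sub (riemannSum (truncPowL2 T k) t N) (truncPowL2 T (k + 1) t),
      ae_restrict_mem measurableSet_Icc] with u h1 h2 h3 hu
    rw [h3, Pi.sub_apply, h1, h2, norm_sub_rev]
    exact abs_truncPow_sub_riemannSum_le k N hN ht hu.1
  refine squeeze_zero' (Eventually.of_forall fun _ => norm_nonneg _) hb ?_
  have h0 : Tendsto (fun N : ℕ => t / (N : ℝ)) atTop (𝓝 0) :=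
    tendsto_const_div_atTop_nhds_zero_nat t
  simpa using (h0.mul_const (|t| ^ k / (k.factorial : ℝ))).const_mul K

/-! ### Iterated derivatives on an interval -/

lemma iteratedDerivWithin_eq_add_integral {f : ℝ → ℝ} {T : ℝ} (hT : 0 < T) {k i : ℕ}
    (hf : ContDiffOn ℝ (k : WithTop ℕ∞) f (Icc 0 T)) (hi : i < k) {t : ℝ} (ht : t ∈ Icc 0 T) :
    iteratedDerivWithin i f (Icc 0 T) t = iteratedDerivWithin i f (Icc 0 T) 0
      + ∫ s in (0 : ℝ)..t, iteratedDerivWithin (i + 1) f (Icc 0 T) s := by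
  have hu := uniqueDiffOn_Icc hT
  have hsub : Icc 0 t ⊆ Icc 0 T := Icc_subset_Icc_right ht.2
  have hdiff : DifferentiableOn ℝ (iteratedDerivWithin i f (Icc 0 T)) (Icc 0 T) :=
    hf.differentiableOn_iteratedDerivWithin (by exact_mod_cast hi) hu
  have hcont : ContinuousOn (iteratedDerivWithin (i + 1) f (Icc 0 T)) (Icc 0 T) :=
    hf.continuousOn_iteratedDerivWithin (by exact_mod_cast hi) hu
  rw [intervalIntegral.integral_eq_sub_of_hasDerivAt_of_le ht.1 (hdiff.continuousOn.mono hsub)]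
  · ring
  · intro x hx
    rw [iteratedDerivWithin_succ]
    have hx' : x ∈ Icc 0 T := hsub (Ioo_subset_Icc_self hx)
    exact (hdiff x hx').hasDerivWithinAt.hasDerivAt
      (Icc_mem_nhds hx.1 (hx.2.trans_le ht.2))
  · apply ContinuousOn.intervalIntegrable
    rw [uIcc_of_le ht.1]
    exact hcont.mono hsub

/-! ### Integrals of the polynomials `phi` -/

lemma phi_zero (t : ℝ) : phi 0 t = 1 := by simp [phi]

@[fun_prop]
lemma continuous_phi (i : ℕ) : Continuous (phi i) := by
  unfold phi; fun_prop

lemma integral_phi (i : ℕ) (t : ℝ) : ∫ s in (0 : ℝ)..t, phi i s = phi (i + 1) t := by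
  unfold phi
  rw [intervalIntegral.integral_div, integral_pow, Nat.factorial_succ]
  push_cast
  field_simp
  simp

/-! ### White noise as an almost surely linear isometry -/

namespace IsWhiteNoise

variable {Ω : Type*} [MeasurableSpace Ω] {P : Measure Ω} {T : ℝ} {W : TimeL2 T → Ω → ℝ}

lemma memLp (hW : IsWhiteNoise P T W) (f : TimeL2 T) : MemLp (W f) 2 P :=
  (hW.gaussian.hasGaussianLaw_eval f).memLp_two

lemma covariance_eq_inner (hW : IsWhiteNoise P T W) (f g : TimeL2 T) :
    cov[W f, W g; P] = inner ℝ f g := by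
  rw [hW.covariance, L2.inner_def]
  simp [mul_comm]

/-- The variables are centred, so the second moment of the difference is its variance, which
bilinearity of covariance turns into a squared norm. -/
lemma eLpNorm_sub (hW : IsWhiteNoise P T W) (f g : TimeL2 T) :
    eLpNorm (W f - W g) 2 P = ENNReal.ofReal ‖f - g‖ := by
  have := hW.gaussian.isProbabilityMeasure
  have hm := (hW.memLp f).sub (hW.memLp g)
  have hmean : ∫ ω, (W f - W g) ω ∂P = 0 := by
    simp only [Pi.sub_apply]
    rw [integral_sub ((hW.memLp f).integrable one_le_two) ((hW.memLp g).integrable one_le_two),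
      hW.mean_zero, hW.mean_zero, sub_zero]
  have hcov : cov[W f - W g, W f - W g; P] = ‖f - g‖ ^ 2 := by
    rw [covariance_sub_left (hW.memLp f) (hW.memLp g) hm,
      covariance_sub_right (hW.memLp f) (hW.memLp f) (hW.memLp g),
      covariance_sub_right (hW.memLp g) (hW.memLp f) (hW.memLp g)]
    simp only [hW.covariance_eq_inner]
    rw [← real_inner_self_eq_norm_sq, inner_sub_left, inner_sub_right, inner_sub_right]
  rw [covariance_self hm.aestronglyMeasurable.aemeasurable,
    variance_of_integral_eq_zero hm.aestronglyMeasurable.aemeasurable hmean] at hcov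
  have h2 := hm.eLpNorm_eq_integral_rpow_norm two_ne_zero ENNReal.ofNat_ne_top
  rw [h2]
  congr 1
  simp only [ENNReal.toReal_ofNat, Real.rpow_two, Real.norm_eq_abs, sq_abs]
  rw [hcov, show (2 : ℝ)⁻¹ = 1 / 2 by norm_num, ← Real.sqrt_eq_rpow, Real.sqrt_sq (norm_nonneg _)]

lemma ae_eq_zero_of_covariance {X : Ω → ℝ} [IsProbabilityMeasure P] (hX : MemLp X 2 P)
    (hmean : ∫ ω, X ω ∂P = 0) (hcov : cov[X, X; P] = 0) : X =ᵐ[P] 0 := by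
  have hm := hX.aestronglyMeasurable.aemeasurable
  rw [covariance_self hm, variance_of_integral_eq_zero hm hmean,
    integral_eq_zero_iff_of_nonneg (fun ω => sq_nonneg (X ω)) hX.integrable_sq] at hcov
  filter_upwards [hcov] with ω h
  simpa using h

/-- Linearity is not part of the definition of white noise; it holds almost surely because the
defect has mean and variance zero. -/
lemma map_add (hW : IsWhiteNoise P T W) (f g : TimeL2 T) : W (f + g) =ᵐ[P] W f + W g := by
  have := hW.gaussian.isProbabilityMeasure
  have hf := hW.memLp f
  have hg := hW.memLp g
  have hfg := hW.memLp (f + g)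
  have h := ae_eq_zero_of_covariance (X := W (f + g) - (W f + W g)) (hfg.sub (hf.add hg)) ?_ ?_
  · filter_upwards [h] with ω h
    simpa [sub_eq_zero] using h
  · rw [integral_sub' (hfg.integrable one_le_two)
      ((hf.integrable one_le_two).add (hg.integrable one_le_two)),
      integral_add' (hf.integrable one_le_two) (hg.integrable one_le_two)]
    simp [hW.mean_zero]
  · rw [covariance_sub_sub hfg (hf.add hg) hfg (hf.add hg), covariance_add_right hfg hf hg,
      covariance_add_left hf hg hfg, covariance_add_left hf hg (hf.add hg),
      covariance_add_right hf hf hg, covariance_add_right hg hf hg]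
    simp only [hW.covariance_eq_inner, inner_add_left, inner_add_right]
    ring

lemma map_smul (hW : IsWhiteNoise P T W) (c : ℝ) (f : TimeL2 T) :
    W (c • f) =ᵐ[P] c • W f := by
  have := hW.gaussian.isProbabilityMeasure
  have hf := hW.memLp f
  have hcf := hW.memLp (c • f)
  have hf' : MemLp (c • W f) 2 P := hf.const_smul c
  have h := ae_eq_zero_of_covariance (X := W (c • f) - c • W f) (hcf.sub hf') ?_ ?_
  · filter_upwards [h] with ω h
    simpa [sub_eq_zero] using h
  · simp only [Pi.sub_apply, Pi.smul_apply, smul_eq_mul]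
    rw [integral_sub (hcf.integrable one_le_two) ((hf.integrable one_le_two).const_mul c),
      integral_const_mul]
    simp [hW.mean_zero]
  · rw [covariance_sub_sub hcf hf' hcf hf', covariance_smul_right, covariance_smul_left,
      covariance_smul_left, covariance_smul_right]
    simp only [hW.covariance_eq_inner, real_inner_smul_left, real_inner_smul_right]
    ring

lemma map_riemannSum (hW : IsWhiteNoise P T W) (h : ℝ → TimeL2 T) (t : ℝ) (N : ℕ) :
    ∀ᵐ ω ∂P, W (riemannSum h t N) ω = riemannSum (fun s => W (h s) ω) t N := by
  unfold riemannSum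
  generalize Finset.range N = s
  induction s using Finset.induction_on with
  | empty =>
    filter_upwards [hW.map_smul 0 0] with ω h0
    simpa using h0
  | insert j s hj ih =>
    simp only [Finset.sum_insert hj]
    filter_upwards [ih, hW.map_add ((t / N) • h (t / N * j)) (∑ j ∈ s, (t / N) • h (t / N * j)),
      hW.map_smul (t / N) (h (t / N * j))] with ω h1 h2 h3
    rw [h2, Pi.add_apply, h1, h3, Pi.smul_apply]

lemma tendstoInMeasure (hW : IsWhiteNoise P T W) {f : ℕ → TimeL2 T} {g : TimeL2 T}
    (h : Tendsto f atTop (𝓝 g)) : TendstoInMeasure P (fun N => W (f N)) atTop (W g) := by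
  refine tendstoInMeasure_of_tendsto_eLpNorm two_ne_zero
    (fun N => (hW.memLp (f N)).aestronglyMeasurable) (hW.memLp g).aestronglyMeasurable ?_
  simp only [hW.eLpNorm_sub]
  rw [tendsto_iff_norm_sub_tendsto_zero] at h
  simpa using ENNReal.tendsto_ofReal h

/-- Almost sure integration of a process with continuous paths which is, up to modification, a
random continuous function plus `W (truncPow k t)`. -/
lemma integral_eq (hW : IsWhiteNoise P T W) {Y p : ℝ → Ω → ℝ} {σ : ℝ} {k : ℕ}
    (hY : ∀ᵐ ω ∂P, ContinuousOn (fun s => Y s ω) (Icc 0 T))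
    (hp : ∀ ω, Continuous fun s => p s ω)
    (h : ∀ t ∈ Icc (0 : ℝ) T, ∀ᵐ ω ∂P, Y t ω = p t ω + σ * W (truncPowL2 T k t) ω)
    {t : ℝ} (ht : t ∈ Icc (0 : ℝ) T) :
    ∀ᵐ ω ∂P, ∫ s in (0 : ℝ)..t, Y s ω
      = (∫ s in (0 : ℝ)..t, p s ω) + σ * W (truncPowL2 T (k + 1) t) ω := by
  have := hW.gaussian.isProbabilityMeasure
  have hsub : Icc 0 t ⊆ Icc 0 T := Icc_subset_Icc_right ht.2
  have hlin : ∀ N : ℕ, ∀ᵐ ω ∂P,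
      riemannSum (fun s => Y s ω - p s ω) t N = W (σ • riemannSum (truncPowL2 T k) t N) ω := by
    intro N
    -- The exceptional set of `h` depends on the time, but a Riemann sum uses only finitely many
    -- times.
    have hall : ∀ᵐ ω ∂P, ∀ j ∈ Finset.range N, Y (t / N * j) ω
        = p (t / N * j) ω + σ * W (truncPowL2 T k (t / N * j)) ω := by
      refine (ae_ball_iff (Finset.countable_toSet (Finset.range N))).2 fun j hj => ?_
      rw [Finset.mem_coe] at hj
      exact h _ (hsub (mul_div_mem_Icc ht.1 (Finset.mem_range.1 hj).le))
    filter_upwards [hall, hW.map_riemannSum (truncPowL2 T k) t N,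
      hW.map_smul σ (riemannSum (truncPowL2 T k) t N)] with ω h1 h2 h3
    rw [h3, Pi.smul_apply, h2, riemannSum, riemannSum, Finset.smul_sum]
    refine Finset.sum_congr rfl fun j hj => ?_
    rw [h1 j hj]
    simp only [smul_eq_mul]
    ring
  have hM : TendstoInMeasure P (fun N => W (σ • riemannSum (truncPowL2 T k) t N)) atTop
      (W (σ • truncPowL2 T (k + 1) t)) :=
    hW.tendstoInMeasure ((tendsto_riemannSum_truncPowL2 T k ht.1).const_smul σ)
  -- The sums are kept in the form `W (...)`, whose measurability is known; none is assumed for Y or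
  -- p.
  have hA : TendstoInMeasure P (fun N => W (σ • riemannSum (truncPowL2 T k) t N)) atTop
      (fun ω => ∫ s in (0 : ℝ)..t, (Y s ω - p s ω)) := by
    refine tendstoInMeasure_of_tendsto_ae (fun N => (hW.memLp _).aestronglyMeasurable) ?_
    filter_upwards [ae_all_iff.2 hlin, hY] with ω h1 h2
    simp only [← h1]
    exact tendsto_riemannSum ht.1 ((h2.mono hsub).sub (hp ω).continuousOn)
  filter_upwards [tendstoInMeasure_ae_unique hA hM, hW.map_smul σ (truncPowL2 T (k + 1) t), hY]
    with ω h1 h2 h3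
  rw [h2, intervalIntegral.integral_sub] at h1
  · simp only [Pi.smul_apply, smul_eq_mul] at h1
    linarith
  · apply ContinuousOn.intervalIntegrable
    rw [uIcc_of_le ht.1]
    exact h3.mono hsub
  · exact (hp ω).intervalIntegrable _ _

lemma integral_sum_phi (hW : IsWhiteNoise P T W) {Y : ℝ → Ω → ℝ} {c : ℕ → Ω → ℝ} {σ : ℝ}
    {k r d : ℕ} (hY : ∀ᵐ ω ∂P, ContinuousOn (fun s => Y s ω) (Icc 0 T))
    (h : ∀ t ∈ Icc (0 : ℝ) T, ∀ᵐ ω ∂P, Y t ω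
      = ∑ i ∈ Finset.range r, c i ω * phi (d + i) t + σ * W (truncPowL2 T k t) ω)
    {t : ℝ} (ht : t ∈ Icc (0 : ℝ) T) :
    ∀ᵐ ω ∂P, ∫ s in (0 : ℝ)..t, Y s ω
      = ∑ i ∈ Finset.range r, c i ω * phi (d + 1 + i) t
        + σ * W (truncPowL2 T (k + 1) t) ω := by
  filter_upwards [hW.integral_eq hY (fun ω => by fun_prop) h ht] with ω h1
  rw [h1, intervalIntegral.integral_finsetSum]
  · congr 1
    refine Finset.sum_congr rfl fun i _ => ?_
    rw [intervalIntegral.integral_const_mul, integral_phi, Nat.add_right_comm]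
  · intro i _
    exact ((continuous_phi _).const_mul _).intervalIntegrable _ _

/-- If `F 0, …, F k` are successive derivatives with continuous paths and `F k` is
`F k 0 + σ W`, then each `F (k - j)` is a Taylor polynomial plus a white noise integral. -/
lemma taylor (hW : IsWhiteNoise P T W) {F : ℕ → ℝ → Ω → ℝ} {σ : ℝ} {k : ℕ}
    (hF : ∀ᵐ ω ∂P, ∀ i ≤ k, ContinuousOn (fun s => F i s ω) (Icc 0 T))
    (hint : ∀ᵐ ω ∂P, ∀ i < k, ∀ t ∈ Icc (0 : ℝ) T,
      F i t ω = F i 0 ω + ∫ s in (0 : ℝ)..t, F (i + 1) s ω)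
    (htop : ∀ t ∈ Icc (0 : ℝ) T, ∀ᵐ ω ∂P, F k t ω = F k 0 ω + σ * W (truncPowL2 T 0 t) ω)
    {j : ℕ} (hj : j ≤ k) {t : ℝ} (ht : t ∈ Icc (0 : ℝ) T) :
    ∀ᵐ ω ∂P, F (k - j) t ω = ∑ i ∈ Finset.range (j + 1), F (k - j + i) 0 ω * phi i t
      + σ * W (truncPowL2 T j t) ω := by
  induction j generalizing t with
  | zero =>
    filter_upwards [htop t ht] with ω h
    simpa [phi_zero] using h
  | succ j ih =>
    obtain ⟨i, hi⟩ : ∃ i, k = i + 1 + j := ⟨k - (j + 1), by omega⟩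
    have e1 : k - j = i + 1 := by omega
    have e2 : k - (j + 1) = i := by omega
    rw [e1] at ih
    rw [e2]
    have hstep := hW.integral_sum_phi (Y := F (i + 1)) (c := fun l => F (i + 1 + l) 0) (d := 0)
      (k := j) (r := j + 1) (σ := σ) (hF.mono fun ω h => h _ (by omega))
      (fun s hs => by simpa using ih (by omega) hs) ht
    filter_upwards [hint, hstep] with ω h1 h2
    -- The split-off term i = 0 is the new initial value; the others come from integrating the
    -- previous polynomial.
    rw [h1 i (by omega) t ht, h2, Finset.sum_range_succ' _ (j + 1)]
    simp only [phi_zero, mul_one, add_zero, add_comm _ 1,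
      ← add_assoc]
    simp only [add_comm, add_left_comm]

end IsWhiteNoise

/-! ### Solution of the integrated stochastic differential equation -/

/-- The `j`-fold iterated primitive of `f` vanishing at `0`. -/
noncomputable def iteratedPrimitive : ℕ → (ℝ → ℝ) → ℝ → ℝ
  | 0, f => f
  | j + 1, f => fun t => ∫ s in (0 : ℝ)..t, iteratedPrimitive j f s

lemma continuousOn_iteratedPrimitive {f : ℝ → ℝ} {T : ℝ} (hT : 0 ≤ T)
    (hf : ContinuousOn f (Icc 0 T)) (j : ℕ) : ContinuousOn (iteratedPrimitive j f) (Icc 0 T) := by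
  induction j with
  | zero => exact hf
  | succ j ih =>
    have h := intervalIntegral.continuousOn_primitive_interval (μ := volume)
      (f := iteratedPrimitive j f) (a := 0) (b := T) (by
        rw [uIcc_of_le hT]; exact ih.integrableOn_Icc)
    rwa [uIcc_of_le hT] at h

lemma iteratedPrimitive_fun_zero (j : ℕ) (t : ℝ) : iteratedPrimitive j (fun _ => 0) t = 0 := by
  induction j generalizing t with
  | zero => rfl
  | succ j ih => simp [iteratedPrimitive, ih]

lemma comap_sum_mul_le {Ω : Type*} {k : ℕ} (X : Ω → EuclideanSpace ℝ (Fin k)) {ι : Type*}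
    (a : ℕ → ι → ℝ) :
    MeasurableSpace.comap (fun ω (t : ι) => ∑ i : Fin k, X ω i * a i t) MeasurableSpace.pi
      ≤ MeasurableSpace.comap X inferInstance := by
  have h : Measurable fun (x : EuclideanSpace ℝ (Fin k)) (t : ι) => ∑ i : Fin k, x i * a i t := by
    fun_prop
  exact (h.comp (comap_measurable X)).comap_le

lemma comap_mul_apply_le {Ω E ι : Type*} (V : E → Ω → ℝ) (σ : ℝ) (g : ι → E) :
    MeasurableSpace.comap (fun ω (t : ι) => σ * V (g t) ω) MeasurableSpace.pi
      ≤ MeasurableSpace.comap (fun ω f => V f ω) MeasurableSpace.pi := by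
  have h : Measurable fun (x : E → ℝ) (t : ι) => σ * x (g t) := by
    fun_prop
  exact (h.comp (comap_measurable fun ω f => V f ω)).comap_le

section

variable {Ω : Type*} [MeasurableSpace Ω] {P : Measure Ω} {T : ℝ} {W : TimeL2 T → Ω → ℝ}

lemma IsWhiteNoise.iteratedPrimitive_sum_phi (hW : IsWhiteNoise P T W) (hT : 0 ≤ T)
    {B : ℝ → Ω → ℝ} {c : ℕ → Ω → ℝ} {σ : ℝ} {k r : ℕ}
    (hB : ∀ᵐ ω ∂P, ContinuousOn (fun s => B s ω) (Icc 0 T))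
    (h : ∀ t ∈ Icc (0 : ℝ) T, ∀ᵐ ω ∂P, B t ω
      = ∑ i ∈ Finset.range r, c i ω * phi i t + σ * W (truncPowL2 T k t) ω)
    (j : ℕ) {t : ℝ} (ht : t ∈ Icc (0 : ℝ) T) :
    ∀ᵐ ω ∂P, iteratedPrimitive j (fun s => B s ω) t
      = ∑ i ∈ Finset.range r, c i ω * phi (j + i) t + σ * W (truncPowL2 T (k + j) t) ω := by
  induction j generalizing t with
  | zero => simpa [iteratedPrimitive] using h t ht
  | succ j ih =>
    exact hW.integral_sum_phi (hB.mono fun ω h => continuousOn_iteratedPrimitive hT h j)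
      (fun s hs => ih hs) ht

/-- Subtracting from each D^i X the (k - i)-fold primitive of B removes the drift and leaves a chain
of successive derivatives, to which `IsWhiteNoise.taylor` applies. -/
lemma SolvesSDE.eq_taylor {k : ℕ} {σ : ℝ} {X B : ℝ → Ω → ℝ}
    {x₀ : Ω → EuclideanSpace ℝ (Fin k)} (hX : SolvesSDE P T k σ X B x₀ W)
    (hW : IsWhiteNoise P T W) (hT : 0 < T) (hk : 1 ≤ k)
    (hB : ∀ᵐ ω ∂P, ContinuousOn (fun s => B s ω) (Icc 0 T)) {t : ℝ} (ht : t ∈ Icc (0 : ℝ) T) :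
    ∀ᵐ ω ∂P, X t ω = ∑ i : Fin k, x₀ ω i * phi i t + σ * W (truncPowL2 T (k - 1) t) ω
      + iteratedPrimitive k (fun s => B s ω) t := by
  obtain ⟨k, rfl⟩ : ∃ l, k = l + 1 := ⟨k - 1, by omega⟩
  rw [Nat.add_sub_cancel]
  set F : ℕ → ℝ → Ω → ℝ := fun i t ω => iteratedDerivWithin i (fun t => X t ω) (Icc 0 T) t
    - iteratedPrimitive (k + 1 - i) (fun s => B s ω) t with hFdef
  -- At least one primitive is subtracted for i ≤ k, and it vanishes at 0, so initial values are
  -- unchanged.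
  have hF0 : ∀ i ≤ k, ∀ ω, F i 0 ω = iteratedDerivWithin i (fun t => X t ω) (Icc 0 T) 0 := by
    intro i hi ω
    simp [hFdef, show k + 1 - i = (k - i) + 1 by omega, iteratedPrimitive]
  have hsmooth := hX.smooth
  have heq := hX.equation
  rw [Nat.add_sub_cancel] at hsmooth heq
  have hmain := hW.taylor (F := F) (σ := σ) (k := k) ?_ ?_ ?_ le_rfl ht
  · filter_upwards [hmain, hX.initial] with ω h1 h2
    rw [Nat.sub_self] at h1
    have h3 : F 0 t ω = X t ω - iteratedPrimitive (k + 1) (fun s => B s ω) t := by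
      simp [hFdef]
    rw [h3] at h1
    have h4 : ∑ i ∈ Finset.range (k + 1), F (0 + i) 0 ω * phi i t
        = ∑ i : Fin (k + 1), x₀ ω i * phi i t := by
      rw [Finset.sum_range]
      refine Finset.sum_congr rfl fun i _ => ?_
      rw [zero_add, hF0 i (by omega), h2 i]
    rw [h4] at h1
    linarith
  · filter_upwards [hsmooth, hB] with ω h1 h2 i hi
    exact (h1.continuousOn_iteratedDerivWithin (by exact_mod_cast hi)
      (uniqueDiffOn_Icc hT)).sub (continuousOn_iteratedPrimitive hT.le h2 _)
  · filter_upwards [hsmooth, hB] with ω h1 h2 i hi s hs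
    have hsub : Icc 0 s ⊆ Icc 0 T := Icc_subset_Icc_right hs.2
    rw [hF0 i hi.le]
    simp only [hFdef]
    rw [iteratedDerivWithin_eq_add_integral hT h1 hi hs, intervalIntegral.integral_sub,
      show k + 1 - i = (k + 1 - (i + 1)) + 1 by omega]
    · simp only [iteratedPrimitive]
      ring
    all_goals
      apply ContinuousOn.intervalIntegrable
      rw [uIcc_of_le hs.1]
    · exact (h1.continuousOn_iteratedDerivWithin (by exact_mod_cast hi)
        (uniqueDiffOn_Icc hT)).mono hsub
    · exact (continuousOn_iteratedPrimitive hT.le h2 _).mono hsub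
  · intro s hs
    filter_upwards [heq s hs] with ω h1
    rw [hF0 k le_rfl, ← stepL2_eq_truncPowL2]
    simp only [hFdef, Nat.add_sub_cancel_left, iteratedPrimitive]
    rw [h1]
    ring

/-! ### The components of a nested Gaussian process -/

lemma isZeroMeanGP_sum_mul {k : ℕ} {σ : ℝ} {X : Ω → EuclideanSpace ℝ (Fin k)}
    (hX : HasLaw X (multivariateGaussian 0 (σ ^ 2 • (1 : Matrix (Fin k) (Fin k) ℝ))) P)
    (a : ℕ → ℝ → ℝ) :
    IsZeroMeanGP P T (fun t ω => ∑ i : Fin k, X ω i * a i t)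
      (fun s t => σ ^ 2 * ∑ i ∈ Finset.range k, a i s * a i t) := by
  have hg : HasGaussianLaw X P := hX.hasGaussianLaw
  have := hg.isProbabilityMeasure
  have hgi : ∀ i, HasGaussianLaw (fun ω => X ω i) P := fun i =>
    hg.map_fun (EuclideanSpace.proj i : EuclideanSpace ℝ (Fin k) →L[ℝ] ℝ)
  have hmean : ∀ i, ∫ ω, X ω i ∂P = 0 := by
    intro i
    have h := (EuclideanSpace.proj i : EuclideanSpace ℝ (Fin k) →L[ℝ] ℝ).integral_comp_comm
      hg.integrable
    rw [hX.integral_eq, integral_id_multivariateGaussian] at h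
    simpa using h
  have hS : (σ ^ 2 • (1 : Matrix (Fin k) (Fin k) ℝ)).PosSemidef :=
    Matrix.PosSemidef.one.smul (sq_nonneg σ)
  have hcov : ∀ i j, cov[fun ω => X ω i, fun ω => X ω j; P] = if i = j then σ ^ 2 else 0 := by
    intro i j
    have h := covariance_map_fun (μ := P) (Z := X) (X := fun x : EuclideanSpace ℝ (Fin k) => x i)
      (Y := fun x => x j) (by fun_prop) (by fun_prop) hX.aemeasurable
    rw [← h, hX.map_eq, covariance_eval_multivariateGaussian hS]
    simp [Matrix.one_apply]
  have hmem : ∀ (i : Fin k) (t : ℝ), MemLp (fun ω => X ω i * a i t) 2 P := fun i t =>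
    (hgi i).memLp_two.mul_const (a i t)
  refine ⟨⟨fun I => ?_⟩, fun t => ?_, fun s t => ?_⟩
  · convert! hg.map_fun (ContinuousLinearMap.pi fun t : I => ∑ i : Fin k,
      a i t.1 • (EuclideanSpace.proj i : EuclideanSpace ℝ (Fin k) →L[ℝ] ℝ)) using 1
    ext ω t
    simp [mul_comm]
  · rw [integral_finsetSum _ fun i _ => (hmem i t).integrable one_le_two]
    simp [integral_mul_const, hmean]
  · rw [covariance_fun_sum_fun_sum (fun i => hmem i s) (fun i => hmem i t)]
    simp only [covariance_mul_const_left, covariance_mul_const_right, hcov]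
    simp only [ite_mul, zero_mul, Finset.sum_ite_eq, Finset.mem_univ, if_true]
    rw [Finset.sum_range, Finset.mul_sum]
    refine Finset.sum_congr rfl fun i _ => by ring

lemma IsZeroMeanGP.congr {X Y : Icc (0 : ℝ) T → Ω → ℝ} {K : ℝ → ℝ → ℝ}
    (hX : IsZeroMeanGP P T X K) (h : ∀ t, X t =ᵐ[P] Y t) : IsZeroMeanGP P T Y K := by
  refine ⟨hX.gaussian.congr h, fun t => ?_, fun s t => ?_⟩
  · rw [← integral_congr_ae (h t), hX.mean_zero]
  · rw [← hX.covariance s t, ProbabilityTheory.covariance, ProbabilityTheory.covariance,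
      integral_congr_ae (h s), integral_congr_ae (h t)]
    refine integral_congr_ae ?_
    filter_upwards [h s, h t] with ω h1 h2
    rw [h1, h2]

lemma IsWhiteNoise.isZeroMeanGP (hW : IsWhiteNoise P T W) (σ : ℝ) {k : ℕ} (hk : 1 ≤ k) :
    IsZeroMeanGP P T (fun t ω => σ * W (truncPowL2 T k t) ω)
      (fun s t => σ ^ 2 * ∫ u in Icc (0 : ℝ) T, greenG (k + 1) s u * greenG (k + 1) t u) := by
  refine ⟨?_, fun t => ?_, fun s t => ?_⟩
  · exact (hW.gaussian.comp_right fun t : Icc (0 : ℝ) T => truncPowL2 T k t).smul fun _ => σ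
  · rw [integral_const_mul, hW.mean_zero, mul_zero]
  · rw [covariance_const_mul_left, covariance_const_mul_right, hW.covariance, ← mul_assoc, ← sq]
    congr 1
    refine integral_congr_ae ?_
    filter_upwards [coeFn_truncPowL2 T k s, coeFn_truncPowL2 T k t] with u h1 h2
    rw [h1, h2, truncPow_eq_greenG hk, truncPow_eq_greenG hk]

end

/-! ### The decomposition theorem -/

theorem lemma1 {Ω : Type*} [MeasurableSpace Ω] (P : Measure Ω) [IsProbabilityMeasure P]
    (T : ℝ) (hT : 0 < T) (m n : ℕ) (hm : 2 ≤ m) (hn : 1 ≤ n)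
    (σμ σα σU σA : ℝ) (hσU : 0 < σU) (hσA : 0 < σA)
    (U A : ℝ → Ω → ℝ)
    (μ : Ω → EuclideanSpace ℝ (Fin m)) (α : Ω → EuclideanSpace ℝ (Fin n))
    (WU WA : TimeL2 T → Ω → ℝ)
    (hU : IsNestedGP P T m n σμ σα σU σA U A μ α WU WA) :
    ∃ U₀ U₁ A₀ A₁ : Icc (0 : ℝ) T → Ω → ℝ,
      (∀ (t : Icc (0 : ℝ) T) (ω : Ω), U (t : ℝ) ω = U₀ t ω + U₁ t ω + A₀ t ω + A₁ t ω) ∧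
      iIndepFun (fun (k : Fin 4) ω t => (![U₀, U₁, A₀, A₁] k) t ω) P ∧
      IsZeroMeanGP P T U₀
        (fun s t => σμ ^ 2 * ∑ i ∈ Finset.range m, phi i s * phi i t) ∧
      IsZeroMeanGP P T U₁
        (fun s t => σU ^ 2 * ∫ u in Icc (0 : ℝ) T, greenG m s u * greenG m t u) ∧
      IsZeroMeanGP P T A₀
        (fun s t => σα ^ 2 * ∑ i ∈ Finset.range n, phi (m + i) s * phi (m + i) t) ∧
      IsZeroMeanGP P T A₁
        (fun s t => σA ^ 2 * ∫ u in Icc (0 : ℝ) T, greenG (m + n) s u * greenG (m + n) t u) := by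
  have hAcont : ∀ᵐ ω ∂P, ContinuousOn (fun s => A s ω) (Icc 0 T) :=
    hU.sde_A.smooth.mono fun ω h => h.continuousOn
  have hA : ∀ t ∈ Icc (0 : ℝ) T, ∀ᵐ ω ∂P, A t ω
      = ∑ i ∈ Finset.range n, (if h : i < n then α ω ⟨i, h⟩ else 0) * phi i t
        + σA * WA (truncPowL2 T (n - 1) t) ω := by
    intro t ht
    filter_upwards [hU.sde_A.eq_taylor hU.noise_A hT hn
      (ae_of_all _ fun _ => continuousOn_const) ht] with ω h
    rw [h, iteratedPrimitive_fun_zero, add_zero, Finset.sum_range]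
    simp
  let U₀ : Icc (0 : ℝ) T → Ω → ℝ := fun t ω => ∑ i : Fin m, μ ω i * phi i t
  let V₁ : Icc (0 : ℝ) T → Ω → ℝ := fun t ω => σU * WU (truncPowL2 T (m - 1) t) ω
  let A₀ : Icc (0 : ℝ) T → Ω → ℝ := fun t ω => ∑ i : Fin n, α ω i * phi (m + i) t
  let A₁ : Icc (0 : ℝ) T → Ω → ℝ := fun t ω => σA * WA (truncPowL2 T (m + n - 1) t) ω
  -- Taylor's formula holds only almost surely at each t. Taking U₁ as the remainder makes the
  -- decomposition exact for every ω; it is a modification of V₁, so law and independence carry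
  -- over.
  let U₁ : Icc (0 : ℝ) T → Ω → ℝ := fun t ω => U t ω - U₀ t ω - A₀ t ω - A₁ t ω
  have hV : ∀ t, V₁ t =ᵐ[P] U₁ t := by
    intro t
    filter_upwards [hU.sde_U.eq_taylor hU.noise_U hT (by omega) hAcont t.2,
      hU.noise_A.iteratedPrimitive_sum_phi hT.le hAcont hA m t.2] with ω h1 h2
    rw [h2, Finset.sum_range, show n - 1 + m = m + n - 1 by omega] at h1
    simp only [Fin.is_lt, dite_true, Fin.eta] at h1
    simp only [U₁, V₁, U₀, A₀, A₁, h1]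
    ring
  refine ⟨U₀, U₁, A₀, A₁, fun t ω => by simp only [U₁]; ring, ?_, ?_, ?_, ?_, ?_⟩
  · have hind : iIndepFun (fun (k : Fin 4) ω t => (![U₀, V₁, A₀, A₁] k) t ω) P := by
      rw [iIndepFun_iff]
      intro s f hf
      -- Reorders the sources from μ, α, WU, WA to μ, WU, α, WA, matching U₀, V₁, A₀, A₁.
      have hperm := hU.indep.precomp (g := ![0, 2, 1, 3]) (by decide)
      refine hperm.meas_biInter fun i hi => ?_
      have hfi := hf i hi
      fin_cases i
      · exact comap_sum_mul_le μ (fun i (t : Icc (0 : ℝ) T) => phi i t) _ hfi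
      · exact comap_mul_apply_le WU σU (fun t : Icc (0 : ℝ) T => truncPowL2 T (m - 1) t)
          _ hfi
      · exact comap_sum_mul_le α (fun i (t : Icc (0 : ℝ) T) => phi (m + i) t) _ hfi
      · exact comap_mul_apply_le WA σA
          (fun t : Icc (0 : ℝ) T => truncPowL2 T (m + n - 1) t) _ hfi
    refine hind.process_congr fun i t => ?_
    fin_cases i
    · exact EventuallyEq.rfl
    · exact hV t
    · exact EventuallyEq.rfl
    · exact EventuallyEq.rfl
  · exact isZeroMeanGP_sum_mul hU.law_μ phi
  · have h := (hU.noise_U.isZeroMeanGP σU (k := m - 1) (by omega)).congr hV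
    rwa [show m - 1 + 1 = m by omega] at h
  · exact isZeroMeanGP_sum_mul hU.law_α fun i => phi (m + i)
  · have h := hU.noise_A.isZeroMeanGP σA (k := m + n - 1) (by omega)
    rwa [show m + n - 1 + 1 = m + n by omega] at h
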